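/- Let $n\ge 1$, $\kappa\ge 0$ and $\rho>0$. Index vectors from $0$. Let $v=(1,\dots,1,0,\dots,0)\in\mathbb{R}^{2n}$ ($n$ ones followed by $n$ zeros), let $v^{\mathrm{DFT}}_k=\sum_{a=0}^{2n-1}v_a e^{-2\pi i ka/(2n)}$, let $F\in\mathbb{C}^{2n\times 2n}$ be the unitary DFT matrix, $F_{ka}=\frac{1}{\sqrt{2n}}e^{-2\pi i ka/(2n)}$, and let $\Sigma^{1/2}$ be the diagonal matrix of the principal square roots of the entries $v^{\mathrm{DFT}}_k$. Put $$\sigma^2=\frac{\kappa^2\,\|v^{\mathrm{DFT}}\|_1}{4n\rho}.$$ The FFT prefix-sum mechanism draws $w\in\mathbb{C}^{2n}$ whose coordinates are independent standard complex normals (independent real and imaginary parts, each distributed as $N(0,1)$), sets $z=\sigma F^*\Sigma^{1/2}w$, and, on a stream $x_0,\dots,x_{n-1}\in\mathbb{R}$, outputs at step $t$ the value $a_t=x_0+\dots+x_t+\operatorname{Re} z_t$. Adaptive continual release model with single participation: an adversary holds private random coins and, at each step $t$, chooses (measurably) two real numbers $g_t,h_t$ as functions of its coins and of the earlier answers $a_0,\dots,a_{t-1}$.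 It must guarantee that, whatever the coins and the answers are, the two streams $(g_t)_t$ and $(h_t)_t$ are neighboring: they differ in at most one step, and there by at most $\kappa$. Either all the $g_t$ or all the $h_t$ are fed to the mechanism. Let $P_g$ and $P_h$ be the laws of the adversary's view (its coins and all answers $a_0,\dots,a_{n-1}$) in these two games. Theorem. The FFT prefix-sum mechanism is $\rho$-zCDP in the adaptive continual release model under single participation: for every such adversary and every real $\alpha>1$, the Rényi divergences of order $\alpha$ satisfy $D_\alpha(P_g\,\|\,P_h)\le\rho\alpha$ and $D_\alpha(P_h\,\|\,P_g)\le\rho\alpha$. -/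

import Mathlib

open MeasureTheory ProbabilityTheory
open scoped ENNReal

universe u

/-- Rényi divergence of order `α > 1` between probability measures:
`D_α(P ‖ Q) = (α - 1)⁻¹ log ∫ (dP/dQ)^α dQ`, and `+∞` if `P` is not absolutely continuous
with respect to `Q`. -/
noncomputable def renyiDiv {X : Type*} [MeasurableSpace X] (α : ℝ) (P Q : Measure X) : EReal :=
  open Classical in
  if P ≪ Q then (((α - 1)⁻¹ : ℝ) : EReal) * ENNReal.log (∫⁻ x, (P.rnDeriv Q x) ^ α ∂Q) else ⊤

/-- A randomized mechanism on real streams of length `n` with one real output per step. The random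
seed is drawn once from `law`; the output at step `t` is a function of the entries `x_0, …, x_t`
received so far and of the seed. -/
structure StreamMechanism (n : ℕ) where
  Seed : Type
  measurableSpace : MeasurableSpace Seed
  law : Measure Seed
  isProb : IsProbabilityMeasure law
  out : (t : Fin n) → (Fin (t + 1) → ℝ) → Seed → ℝ
  measurable_out : ∀ t : Fin n, Measurable (fun p : (Fin (t + 1) → ℝ) × Seed => out t p.1 p.2)

attribute [instance] StreamMechanism.measurableSpace StreamMechanism.isProb

/-- The answers `a_0, …, a_{n-1}` of the mechanism run with the given seed, when the entry at
step `s` is `q s (a_0, …, a_{s-1})`. -/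
noncomputable def StreamMechanism.answer {n : ℕ} (M : StreamMechanism n)
    (q : (s : Fin n) → (Fin s → ℝ) → ℝ) (seed : M.Seed) (t : Fin n) : ℝ :=
  M.out t (fun s : Fin (t + 1) =>
    q ⟨s, by omega⟩ (fun r : Fin s => M.answer q seed ⟨r, by omega⟩)) seed
termination_by t.val
decreasing_by
  have h1 := r.isLt
  have _ := s.isLt
  show r.val < t.val
  omega

/-- A (randomized) adversary in the adaptive continual release model. It draws private coins and, at
each step `t`, chooses two entries `left` and `right` as functions of its coins and of the answers
`a_0, …, a_{t-1}` seen so far. -/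
structure StreamAdversary (n : ℕ) where
  Coins : Type u
  measurableSpace : MeasurableSpace Coins
  law : Measure Coins
  isProb : IsProbabilityMeasure law
  left : (t : Fin n) → Coins → (Fin t → ℝ) → ℝ
  right : (t : Fin n) → Coins → (Fin t → ℝ) → ℝ
  measurable_left : ∀ t : Fin n, Measurable (fun p : Coins × (Fin t → ℝ) => left t p.1 p.2)
  measurable_right : ∀ t : Fin n, Measurable (fun p : Coins × (Fin t → ℝ) => right t p.1 p.2)

attribute [instance] StreamAdversary.measurableSpace StreamAdversary.isProb

/-- The adversary keeps its promise: whatever its coins and the answers are, the two streams that it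
produces are neighboring. -/
def StreamAdversary.Valid {n : ℕ} (N : (Fin n → ℝ) → (Fin n → ℝ) → Prop)
    (A : StreamAdversary.{u} n) : Prop :=
  ∀ (c : A.Coins) (a : Fin n → ℝ),
    N (fun t => A.left t c (fun s => a ⟨s, s.isLt.trans t.isLt⟩))
      (fun t => A.right t c (fun s => a ⟨s, s.isLt.trans t.isLt⟩))

/-- The law of the adversary's view (its coins and all answers of the mechanism) in the game where
the entries given by `q` are fed to the mechanism. -/
noncomputable def StreamAdversary.view {n : ℕ} (A : StreamAdversary.{u} n) (M : StreamMechanism n)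
    (q : (t : Fin n) → A.Coins → (Fin t → ℝ) → ℝ) : Measure (A.Coins × (Fin n → ℝ)) :=
  (A.law.prod M.law).map (fun p => (p.1, M.answer (fun t => q t p.1) p.2))

/-- The answers are jointly measurable in coins and seed, so that the law of the view is a genuine
push-forward. -/
theorem StreamAdversary.measurable_view {n : ℕ} (A : StreamAdversary.{u} n) (M : StreamMechanism n)
    (q : (t : Fin n) → A.Coins → (Fin t → ℝ) → ℝ)
    (hq : ∀ t : Fin n, Measurable (fun p : A.Coins × (Fin t → ℝ) => q t p.1 p.2)) :
    Measurable (fun p : A.Coins × M.Seed => (p.1, M.answer (fun t => q t p.1) p.2)) := by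
  have key : ∀ (m : ℕ) (hm : m < n),
      Measurable (fun p : A.Coins × M.Seed => M.answer (fun t => q t p.1) p.2 ⟨m, hm⟩) := by
    intro m
    induction m using Nat.strong_induction_on with
    | _ m ih =>
      intro hm
      have h : (fun p : A.Coins × M.Seed => M.answer (fun t => q t p.1) p.2 ⟨m, hm⟩) =
          fun p => M.out ⟨m, hm⟩ (fun s : Fin (m + 1) =>
            q ⟨s, by omega⟩ p.1 (fun r : Fin s =>
              M.answer (fun t => q t p.1) p.2 ⟨r, by omega⟩)) p.2 := by
        funext p
        rw [StreamMechanism.answer]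
      rw [h]
      refine (M.measurable_out ⟨m, hm⟩).comp (Measurable.prodMk ?_ measurable_snd)
      refine measurable_pi_lambda _ fun s => ?_
      refine (hq ⟨s, by omega⟩).comp (Measurable.prodMk measurable_fst ?_)
      exact measurable_pi_lambda _ fun r => ih r (by have := r.isLt; have := s.isLt; omega) _
  exact Measurable.prodMk measurable_fst (measurable_pi_lambda _ fun t => key t t.isLt)

/-- `ρ`-zCDP in the adaptive continual release model, for the neighboring relation `N`: for each
adversary whose two streams are always neighboring, the Rényi divergences of every order `α > 1`
between its views in the `left` and in the `right` game are at most `ρ α`. -/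
def StreamMechanism.IsAdaptiveZCDP {n : ℕ} (M : StreamMechanism n)
    (N : (Fin n → ℝ) → (Fin n → ℝ) → Prop) (ρ : ℝ) : Prop :=
  ∀ A : StreamAdversary.{u} n, A.Valid N → ∀ α : ℝ, 1 < α →
    renyiDiv α (A.view M A.left) (A.view M A.right) ≤ ((ρ * α : ℝ) : EReal) ∧
    renyiDiv α (A.view M A.right) (A.view M A.left) ≤ ((ρ * α : ℝ) : EReal)

/-- Single participation: neighboring streams differ in the entry of a single step, by at
most `κ`. -/
def SingleParticipation (n : ℕ) (κ : ℝ) (x y : Fin n → ℝ) : Prop :=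
  ∃ i, (∀ j, j ≠ i → x j = y j) ∧ |x i - y i| ≤ κ

/-- `v = (1, …, 1, 0, …, 0)` with `n` ones and `n` zeros: the first column of the circulant
extension of the prefix-sum matrix. -/
def fftV (n : ℕ) (a : Fin (2 * n)) : ℂ := if (a : ℕ) < n then 1 else 0

/-- The (unnormalized) discrete Fourier transform of `v`. -/
noncomputable def fftVDFT (n : ℕ) (k : Fin (2 * n)) : ℂ :=
  ∑ a : Fin (2 * n), fftV n a *
    Complex.exp (-(Complex.I * 2 * Real.pi * (k : ℕ) * (a : ℕ)) / (2 * n))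

/-- The (unitary) DFT matrix in dimension `2n`. -/
noncomputable def fftMatrix (n : ℕ) : Matrix (Fin (2 * n)) (Fin (2 * n)) ℂ :=
  Matrix.of fun k a => ((1 / Real.sqrt (2 * n) : ℝ) : ℂ) *
    Complex.exp (-(Complex.I * 2 * Real.pi * (k : ℕ) * (a : ℕ)) / (2 * n))

/-- The entrywise principal square root `Σ^{1/2}` of `Σ = diag(v^DFT)`. -/
noncomputable def fftSqrtSigma (n : ℕ) : Matrix (Fin (2 * n)) (Fin (2 * n)) ℂ :=
  Matrix.diagonal fun k => (fftVDFT n k) ^ (1 / 2 : ℂ)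

/-- The noise scale `σ = √(κ² ‖v^DFT‖₁ / (4 n ρ))`. -/
noncomputable def fftSigma (n : ℕ) (κ ρ : ℝ) : ℝ :=
  Real.sqrt (κ ^ 2 * (∑ k, ‖fftVDFT n k‖) / (4 * n * ρ))

/-- The noise vector `z = σ F^* Σ^{1/2} w`. -/
noncomputable def fftNoise (n : ℕ) (κ ρ : ℝ) (w : Fin (2 * n) → ℂ) : Fin (2 * n) → ℂ :=
  (fftSigma n κ ρ : ℂ) •
    ((fftMatrix n).conjTranspose.mulVec ((fftSqrtSigma n).mulVec w))

/-- The standard complex normal: independent real and imaginary parts, each `N(0, 1)`. -/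
noncomputable def stdComplexNormal : Measure ℂ :=
  ((gaussianReal 0 1).prod (gaussianReal 0 1)).map Complex.measurableEquivRealProd.symm

instance : IsProbabilityMeasure stdComplexNormal :=
  Measure.isProbabilityMeasure_map Complex.measurableEquivRealProd.symm.measurable.aemeasurable

/-- The FFT prefix-sum mechanism: with `w` a standard complex normal vector in dimension `2n`, the
output at step `t` is `x_0 + … + x_t + Re z_t`. -/
noncomputable def fftMechanism (n : ℕ) (κ ρ : ℝ) : StreamMechanism n where
  Seed := Fin (2 * n) → ℂ
  measurableSpace := inferInstance
  law := Measure.pi fun _ => stdComplexNormal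
  isProb := inferInstance
  out t x w := (∑ s, x s) + (fftNoise n κ ρ w ⟨t, by omega⟩).re
  measurable_out t := by
    simp only [fftNoise, Matrix.mulVec, dotProduct, Pi.smul_apply, smul_eq_mul]
    fun_prop

/-!
Write the Gaussian noise as `Re z_t = ⟪l t, w⟫`, and let `μ i = σ⁻¹ Σ^{1/2} F e_i`. Since
`F^* diag(v^DFT) F` is the circulant matrix with first column `v`, one has `⟪l t, μ i⟫ = 1_{i ≤ t}`:
adding `c • μ i` to `w` has the same effect on the answers as adding `c` to the stream entry `x_i`.
So for fixed coins, the answers in one game are those in the other game for the noise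
`w + ∑ i, c_i(w) • μ i`, where `c_i(w)` is the difference of the two adaptively chosen entries at
step `i`. Because `c_i` is a function of the answers before step `i`, it is invariant under the
directions `μ j`, `j ≥ i`, so this nonlinear substitution is a composition of shears and preserves
Lebesgue measure. Hence the Gaussian computation is the same as for a constant shift, whose squared
norm is at most `κ² ‖μ i‖² = 2ρ`, and the data processing inequality passes to the views.
-/

section Shear

variable {E : Type*} [AddCommGroup E] [Module ℝ E] [MeasurableSpace E] [MeasurableAdd₂ E]
  [MeasurableSMul ℝ E] {μ : Measure E} [SFinite μ] [μ.IsAddRightInvariant]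

/- On `E × ℝ` the shear `(w, s) ↦ (w + c w • v, s)` is a commutator of the skew translations
`(w, s) ↦ (w, s + c w)` and `(w, s) ↦ (w + s • v, s)`; the slab `s ∈ [0, 1]` brings it back to
`E`. -/
theorem measurePreserving_add_smul {c : E → ℝ} (hc : Measurable c) {v : E}
    (hcv : ∀ (r : ℝ) w, c (w + r • v) = c w) :
    MeasurePreserving (fun w => w + c w • v) μ μ := by
  have hclock {b : E → ℝ} (hb : Measurable b) : MeasurePreserving
      (fun p : E × ℝ => (p.1, p.2 + b p.1)) (μ.prod volume) (μ.prod volume) :=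
    (MeasurePreserving.id μ).skew_product (by fun_prop)
      (.of_forall fun w => map_add_right_eq_self volume (b w))
  have hflow (r : ℝ) : MeasurePreserving
      (fun p : E × ℝ => (p.1 + (r * p.2) • v, p.2)) (μ.prod volume) (μ.prod volume) :=
    Measure.measurePreserving_swap.comp <| MeasurePreserving.comp
      (MeasurePreserving.skew_product (g := fun (s : ℝ) w => w + (r * s) • v) (.id volume)
        (by fun_prop) (.of_forall fun s => map_add_right_eq_self μ ((r * s) • v)))
      Measure.measurePreserving_swap
  have hprod : MeasurePreserving (fun p : E × ℝ => (p.1 + c p.1 • v, p.2))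
      (μ.prod volume) (μ.prod volume) := by
    convert (hclock hc.neg).comp ((hflow 1).comp ((hclock hc).comp (hflow (-1)))) using 2 with p
    simp only [Function.comp_apply, Pi.neg_apply, hcv, Prod.mk.injEq]
    exact ⟨by module, by ring⟩
  refine ⟨by fun_prop, Measure.ext fun s hs => ?_⟩
  have hslab := hprod.measure_preimage
    (hs.prod (measurableSet_Icc (a := (0 : ℝ)) (b := 1))).nullMeasurableSet
  rw [show (fun p : E × ℝ => (p.1 + c p.1 • v, p.2)) ⁻¹' s ×ˢ Set.Icc 0 1 =
    ((fun w => w + c w • v) ⁻¹' s) ×ˢ Set.Icc 0 1 from rfl] at hslab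
  rw [Measure.map_apply (by fun_prop) hs]
  simpa only [Measure.prod_prod, Real.volume_Icc, sub_zero, ENNReal.ofReal_one, mul_one] using hslab

theorem measurePreserving_add_sum_smul {ι : Type*} [LinearOrder ι] (s : Finset ι) {c : ι → E → ℝ}
    (hc : ∀ i, Measurable (c i)) {v : ι → E}
    (hcv : ∀ i j, i ≤ j → ∀ (r : ℝ) w, c i (w + r • v j) = c i w) :
    MeasurePreserving (fun w => w + ∑ i ∈ s, c i w • v i) μ μ := by
  induction s using Finset.induction_on_max with
  | empty => simpa using! MeasurePreserving.id μ
  | insert j s hj ih =>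
    convert ih.comp (measurePreserving_add_smul (hc j) (hcv j j le_rfl)) using 2 with w
    simp only [Function.comp_apply, Finset.sum_insert fun h => (hj j h).false, add_assoc]
    congr 2
    exact Finset.sum_congr rfl fun i hi => by rw [hcv i j (hj i hi).le]

end Shear

section Renyi

variable {X Y : Type*} [MeasurableSpace X] [MeasurableSpace Y] {α : ℝ}

theorem eLpNorm_toReal_rnDeriv_rpow {μ ν : Measure X} [SigmaFinite μ] (hα : 0 < α) :
    eLpNorm (fun x => (μ.rnDeriv ν x).toReal) (ENNReal.ofReal α) ν ^ α =
      ∫⁻ x, μ.rnDeriv ν x ^ α ∂ν := by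
  rw [eLpNorm_eq_eLpNorm' (ENNReal.ofReal_pos.2 hα).ne' ENNReal.ofReal_ne_top,
    ENNReal.toReal_ofReal hα.le, ← lintegral_rpow_enorm_eq_rpow_eLpNorm' hα]
  refine lintegral_congr_ae ?_
  filter_upwards [μ.rnDeriv_ne_top ν] with x hx
  rw [Real.enorm_eq_ofReal ENNReal.toReal_nonneg, ENNReal.ofReal_toReal hx]

theorem lintegral_rnDeriv_map_rpow_le {μ ν : Measure X} [IsFiniteMeasure μ] [IsFiniteMeasure ν]
    (hμν : μ ≪ ν) {g : X → Y} (hg : Measurable g) (hα : 1 ≤ α) :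
    ∫⁻ y, (μ.map g).rnDeriv (ν.map g) y ^ α ∂(ν.map g) ≤ ∫⁻ x, μ.rnDeriv ν x ^ α ∂ν := by
  have hα₀ : 0 < α := by linarith
  rw [← eLpNorm_toReal_rnDeriv_rpow hα₀, ← eLpNorm_toReal_rnDeriv_rpow hα₀,
    eLpNorm_map_measure (Measure.measurable_rnDeriv _ _).ennreal_toReal.aestronglyMeasurable
      hg.aemeasurable]
  gcongr
  exact (eLpNorm_congr_ae (toReal_rnDeriv_map hμν hg)).trans_le
    (eLpNorm_condExp_le_eLpNorm _ (by simpa using ENNReal.ofReal_le_ofReal hα))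

theorem renyiDiv_map_le (μ ν : Measure X) [IsFiniteMeasure μ] [IsFiniteMeasure ν] {g : X → Y}
    (hg : Measurable g) (hα : 1 ≤ α) : renyiDiv α (μ.map g) (ν.map g) ≤ renyiDiv α μ ν := by
  by_cases hμν : μ ≪ ν
  · rw [renyiDiv, renyiDiv, if_pos hμν, if_pos (hμν.map hg)]
    refine mul_le_mul_of_nonneg_left
      (ENNReal.log_monotone (lintegral_rnDeriv_map_rpow_le hμν hg hα)) ?_
    exact_mod_cast inv_nonneg.2 (sub_nonneg.2 hα)
  · simp [renyiDiv, if_neg hμν]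

theorem renyiDiv_withDensity (ν : Measure X) [SigmaFinite ν] {f : X → ℝ≥0∞} (hf : Measurable f) :
    renyiDiv α (ν.withDensity f) ν =
      (((α - 1)⁻¹ : ℝ) : EReal) * ENNReal.log (∫⁻ x, f x ^ α ∂ν) := by
  rw [renyiDiv, if_pos (withDensity_absolutelyContinuous ν f)]
  congr 2
  refine lintegral_congr_ae ?_
  filter_upwards [ν.rnDeriv_withDensity hf] with x hx
  rw [hx]

theorem renyiDiv_withDensity_le {ν : Measure X} [SigmaFinite ν] {f : X → ℝ≥0∞} (hf : Measurable f)
    (hα : 1 < α) {B : ℝ} (h : ∫⁻ x, f x ^ α ∂ν ≤ ENNReal.ofReal (Real.exp (α * (α - 1) * B))) :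
    renyiDiv α (ν.withDensity f) ν ≤ ((B * α : ℝ) : EReal) := by
  have hα₀ : 0 < α - 1 := sub_pos.2 hα
  calc renyiDiv α (ν.withDensity f) ν
      = (((α - 1)⁻¹ : ℝ) : EReal) * ENNReal.log (∫⁻ x, f x ^ α ∂ν) := renyiDiv_withDensity ν hf
    _ ≤ (((α - 1)⁻¹ : ℝ) : EReal) *
          ENNReal.log (ENNReal.ofReal (Real.exp (α * (α - 1) * B))) :=
        mul_le_mul_of_nonneg_left (ENNReal.log_monotone h) (mod_cast (inv_pos.2 hα₀).le)
    _ = ((B * α : ℝ) : EReal) := by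
        rw [ENNReal.log_ofReal_of_pos (Real.exp_pos _), Real.log_exp, ← EReal.coe_mul]
        congr 1
        field_simp

theorem renyiDiv_self (μ : Measure X) [IsProbabilityMeasure μ] : renyiDiv α μ μ = 0 := by
  simpa using renyiDiv_withDensity (α := α) μ measurable_one

end Renyi

section Gaussian

open scoped RealInnerProductSpace

theorem map_withDensity_comp {X Y : Type*} [MeasurableSpace X] [MeasurableSpace Y]
    {μ : Measure X} {ν : Measure Y} {φ : X → Y} (hφ : MeasurePreserving φ μ ν) {g : Y → ℝ≥0∞}
    (hg : Measurable g) : (μ.withDensity (g ∘ φ)).map φ = ν.withDensity g := by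
  ext s hs
  rw [Measure.map_apply hφ.measurable hs, withDensity_apply _ (hφ.measurable hs),
    withDensity_apply _ hs, ← hφ.setLIntegral_comp_preimage hs hg]
  rfl

theorem map_pi_stdGaussian {ι : Type*} [Fintype ι] {F : ι → Type*}
    [∀ i, NormedAddCommGroup (F i)] [∀ i, InnerProductSpace ℝ (F i)]
    [∀ i, FiniteDimensional ℝ (F i)] [∀ i, MeasurableSpace (F i)] [∀ i, BorelSpace (F i)] :
    (Measure.pi fun i => stdGaussian (F i)).map (WithLp.toLp 2) = stdGaussian (PiLp 2 F) := by
  refine Measure.ext_of_charFun (funext fun t => ?_)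
  simp_rw [charFun_pi, charFun_stdGaussian, ← Complex.exp_sum]
  congr 1
  rw [← Finset.sum_div, Finset.sum_neg_distrib]
  norm_cast
  rw [PiLp.norm_sq_eq_of_L2]

variable {E : Type*} [NormedAddCommGroup E] [InnerProductSpace ℝ E]

/-- The density of the standard Gaussian measure with respect to Lebesgue measure. -/
noncomputable def stdGaussianPDF (w : E) : ℝ≥0∞ :=
  ENNReal.ofReal ((2 * Real.pi) ^ (-(Module.finrank ℝ E / 2 : ℝ)) * Real.exp (-‖w‖ ^ 2 / 2))

/-- The Radon–Nikodym derivative at `w` of the standard Gaussian measure translated by `-m` with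
respect to the untranslated one. -/
noncomputable def gaussianShiftDensity (m w : E) : ℝ≥0∞ :=
  ENNReal.ofReal (Real.exp (-⟪m, w⟫ - ‖m‖ ^ 2 / 2))

theorem stdGaussianPDF_add (m w : E) :
    stdGaussianPDF (w + m) = gaussianShiftDensity m w * stdGaussianPDF w := by
  rw [stdGaussianPDF, gaussianShiftDensity, stdGaussianPDF,
    ← ENNReal.ofReal_mul (Real.exp_nonneg _), mul_left_comm, ← Real.exp_add,
    norm_add_sq_real, real_inner_comm]
  congr 3
  ring

theorem gaussianShiftDensity_rpow (α : ℝ) (m w : E) :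
    gaussianShiftDensity m w ^ α = ENNReal.ofReal (Real.exp (α * (α - 1) * (‖m‖ ^ 2 / 2))) *
      gaussianShiftDensity (α • m) w := by
  rw [gaussianShiftDensity, gaussianShiftDensity, ENNReal.ofReal_rpow_of_pos (Real.exp_pos _),
    ← Real.exp_mul, ← ENNReal.ofReal_mul (Real.exp_nonneg _), ← Real.exp_add, real_inner_smul_left,
    norm_smul, mul_pow, Real.norm_eq_abs, sq_abs]
  congr 2
  ring

variable [MeasurableSpace E] [BorelSpace E]

@[fun_prop]
theorem measurable_stdGaussianPDF : Measurable (stdGaussianPDF : E → ℝ≥0∞) := by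
  unfold stdGaussianPDF
  fun_prop


@[fun_prop]
theorem measurable_gaussianShiftDensity [SecondCountableTopology E] :
    Measurable fun p : E × E => gaussianShiftDensity p.1 p.2 := by
  unfold gaussianShiftDensity
  fun_prop

variable [FiniteDimensional ℝ E]

theorem stdGaussian_eq_withDensity : stdGaussian E = volume.withDensity stdGaussianPDF := by
  have hint : Integrable fun w : E =>
      (2 * Real.pi) ^ (-(Module.finrank ℝ E / 2 : ℝ)) * Real.exp (-‖w‖ ^ 2 / 2) := by
    refine Integrable.const_mul ?_ _
    have h := (GaussianFourier.integrable_cexp_neg_mul_sq_norm_add (V := E) (b := 1 / 2)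
      (by norm_num) 0 0).norm
    refine h.congr (.of_forall fun w => ?_)
    simp [Complex.norm_exp, ← Complex.ofReal_pow]
    ring
  have : IsFiniteMeasure (volume.withDensity (stdGaussianPDF : E → ℝ≥0∞)) :=
    isFiniteMeasure_withDensity_ofReal hint.2
  refine Measure.ext_of_charFun (funext fun t => ?_)
  rw [charFun_stdGaussian, charFun_apply, integral_withDensity_eq_integral_toReal_smul
    measurable_stdGaussianPDF (.of_forall fun w => ENNReal.ofReal_lt_top)]
  have h2π : (0 : ℝ) ≤ 2 * Real.pi := by positivity
  calc Complex.exp (-‖t‖ ^ 2 / 2)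
      = ((2 * Real.pi) ^ (-(Module.finrank ℝ E / 2 : ℝ)) : ℝ) *
        ∫ w : E, Complex.exp (-(1 / 2) * ‖w‖ ^ 2 + Complex.I * ⟪t, w⟫) := by
        rw [GaussianFourier.integral_cexp_neg_mul_sq_norm_add (by norm_num), ← mul_assoc,
          Complex.I_sq, Real.rpow_neg h2π, Complex.ofReal_inv, Complex.ofReal_cpow h2π]
        push_cast
        rw [one_div, div_inv_eq_mul, mul_comm (Real.pi : ℂ), inv_mul_cancel₀, one_mul]
        · congr 1; ring
        · simp [Complex.cpow_eq_zero_iff, Real.pi_ne_zero]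
    _ = _ := by
        rw [← integral_const_mul]
        refine integral_congr_ae (.of_forall fun w => ?_)
        simp only [stdGaussianPDF]
        rw [ENNReal.toReal_ofReal (by positivity), Complex.real_smul, Complex.ofReal_mul,
          Complex.ofReal_exp, mul_assoc, ← Complex.exp_add, real_inner_comm]
        push_cast
        congr 2
        ring

variable {C : Type*} [MeasurableSpace C] {P : Measure C} {m : C × E → E}

theorem map_withDensity_gaussianShiftDensity (hm : Measurable m)
    (hmp : MeasurePreserving (fun p => (p.1, p.2 + m p)) (P.prod volume) (P.prod volume)) :
    ((P.prod (stdGaussian E)).withDensity fun p => gaussianShiftDensity (m p) p.2).map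
      (fun p => (p.1, p.2 + m p)) = P.prod (stdGaussian E) := by
  have hpdf : Measurable fun p : C × E => stdGaussianPDF p.2 := by fun_prop
  rw [stdGaussian_eq_withDensity, prod_withDensity_right measurable_stdGaussianPDF,
    ← withDensity_mul _ hpdf (by fun_prop), ← map_withDensity_comp hmp hpdf]
  congr 2
  ext p
  simp [stdGaussianPDF_add, mul_comm]

variable [IsProbabilityMeasure P]

theorem lintegral_gaussianShiftDensity (hm : Measurable m)
    (hmp : MeasurePreserving (fun p => (p.1, p.2 + m p)) (P.prod volume) (P.prod volume)) :
    ∫⁻ p, gaussianShiftDensity (m p) p.2 ∂(P.prod (stdGaussian E)) = 1 := by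
  have h := congrArg (· Set.univ) (map_withDensity_gaussianShiftDensity hm hmp)
  simpa [Measure.map_apply hmp.measurable] using h

theorem lintegral_gaussianShiftDensity_rpow_le {α B : ℝ} (hα : 1 ≤ α) (hm : Measurable m)
    (hmp : MeasurePreserving (fun p => (p.1, p.2 + α • m p)) (P.prod volume) (P.prod volume))
    (hB : ∀ p, ‖m p‖ ^ 2 ≤ 2 * B) :
    ∫⁻ p, gaussianShiftDensity (m p) p.2 ^ α ∂(P.prod (stdGaussian E)) ≤
      ENNReal.ofReal (Real.exp (α * (α - 1) * B)) := by
  have hpow (p : C × E) : gaussianShiftDensity (m p) p.2 ^ α ≤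
      ENNReal.ofReal (Real.exp (α * (α - 1) * B)) * gaussianShiftDensity (α • m p) p.2 := by
    rw [gaussianShiftDensity_rpow]
    gcongr
    linarith [hB p]
  refine (lintegral_mono hpow).trans_eq ?_
  rw [lintegral_const_mul' _ _ ENNReal.ofReal_ne_top,
    lintegral_gaussianShiftDensity (m := fun p => α • m p) (hm.const_smul α) hmp, mul_one]

theorem renyiDiv_map_add_le {Y : Type*} [MeasurableSpace Y] {α B : ℝ} (hα : 1 < α)
    (hm : Measurable m) (hmp : ∀ r : ℝ,
      MeasurePreserving (fun p => (p.1, p.2 + r • m p)) (P.prod volume) (P.prod volume))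
    (hB : ∀ p, ‖m p‖ ^ 2 ≤ 2 * B) {f : C × E → Y} (hf : Measurable f) :
    renyiDiv α ((P.prod (stdGaussian E)).map f)
      ((P.prod (stdGaussian E)).map fun p => f (p.1, p.2 + m p)) ≤ ((B * α : ℝ) : EReal) := by
  let γ := P.prod (stdGaussian E)
  let Z (p : C × E) := gaussianShiftDensity (m p) p.2
  have hΦ : MeasurePreserving (fun p => (p.1, p.2 + m p)) (P.prod volume) (P.prod volume) := by
    simpa using hmp 1
  have hfΦ : γ.map f = (γ.withDensity Z).map fun p => f (p.1, p.2 + m p) :=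
    (congrArg (·.map f) (map_withDensity_gaussianShiftDensity hm hΦ)).symm.trans
      (Measure.map_map hf hΦ.measurable)
  have : IsFiniteMeasure (γ.withDensity Z) := by
    refine isFiniteMeasure_withDensity ?_
    rw [lintegral_gaussianShiftDensity hm hΦ]
    exact ENNReal.one_ne_top
  calc renyiDiv α (γ.map f) (γ.map fun p => f (p.1, p.2 + m p))
      ≤ renyiDiv α (γ.withDensity Z) γ := by
        rw [hfΦ]
        exact renyiDiv_map_le _ _ (hf.comp hΦ.measurable) hα.le
    _ ≤ ((B * α : ℝ) : EReal) := renyiDiv_withDensity_le (by fun_prop) hα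
        (lintegral_gaussianShiftDensity_rpow_le hα.le hm (hmp α) hB)

end Gaussian

section AdaptiveStreams

variable {n : ℕ}

/-- The stream produced by a strategy `q` whose entry at step `t` depends on the answers
`a_0, …, a_{t-1}`. -/
def adaptiveStream (q : (t : Fin n) → (Fin t → ℝ) → ℝ) (a : Fin n → ℝ) (t : Fin n) : ℝ :=
  q t (Fin.take t t.isLt.le a)

theorem adaptiveStream_congr (q : (t : Fin n) → (Fin t → ℝ) → ℝ) {a a' : Fin n → ℝ} {t : Fin n}
    (h : ∀ r < t, a r = a' r) : adaptiveStream q a t = adaptiveStream q a' t :=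
  congrArg (q t) (funext fun s => h _ (Fin.lt_def.2 s.isLt))

theorem measurable_adaptiveStream {C : Type*} [MeasurableSpace C]
    {q : (t : Fin n) → C → (Fin t → ℝ) → ℝ} {t : Fin n}
    (hq : Measurable fun p : C × (Fin t → ℝ) => q t p.1 p.2) :
    Measurable fun p : C × (Fin n → ℝ) => adaptiveStream (fun t => q t p.1) p.2 t := by
  refine hq.comp (measurable_fst.prodMk ?_)
  exact measurable_pi_lambda _ fun _ => (measurable_pi_apply _).comp measurable_snd

namespace StreamMechanism

variable {M M' : StreamMechanism n} {q : (t : Fin n) → (Fin t → ℝ) → ℝ} {w : M.Seed}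
  {w' : M'.Seed} {t : Fin n}

theorem answer_apply (M : StreamMechanism n) (q : (t : Fin n) → (Fin t → ℝ) → ℝ) (w : M.Seed)
    (t : Fin n) :
    M.answer q w t = M.out t (Fin.take (t + 1) t.isLt (adaptiveStream q (M.answer q w))) w := by
  rw [answer]
  rfl

theorem eq_answer_of_forall_le {a : Fin n → ℝ}
    (ha : ∀ r ≤ t, a r = M.out r (Fin.take (r + 1) r.isLt (adaptiveStream q a)) w) :
    a t = M.answer q w t := by
  induction t using WellFoundedLT.induction with
  | ind t ih =>
    rw [ha t le_rfl, answer_apply]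
    congr 1
    funext s
    refine adaptiveStream_congr q fun r hr => ?_
    have hrt : r < t := hr.trans_le (Nat.le_of_lt_succ s.isLt)
    exact ih r hrt fun r' hr' => ha r' (hr'.trans hrt.le)

theorem answer_congr (hout : ∀ r ≤ t, ∀ x, M.out r x w = M'.out r x w') :
    M.answer q w t = M'.answer q w' t :=
  eq_answer_of_forall_le fun r hr => by rw [answer_apply, hout r hr]

end StreamMechanism

namespace StreamAdversary

variable {A : StreamAdversary.{u} n} {M M' : StreamMechanism n}

theorem view_congr {ψ : M'.Seed → M.Seed} (hψ : Measurable ψ) (hlaw : M.law = M'.law.map ψ)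
    (hout : ∀ t x w, M.out t x (ψ w) = M'.out t x w) {q : (t : Fin n) → A.Coins → (Fin t → ℝ) → ℝ}
    (hq : ∀ t : Fin n, Measurable fun p : A.Coins × (Fin t → ℝ) => q t p.1 p.2) :
    A.view M q = A.view M' q := by
  have hprod : A.law.prod M.law = (A.law.prod M'.law).map (Prod.map id ψ) := by
    rw [hlaw, ← Measure.map_prod_map _ _ measurable_id hψ, Measure.map_id]
  rw [view, hprod, Measure.map_map (A.measurable_view M q hq) (measurable_id.prodMap hψ), view]
  congr 1
  funext p
  exact Prod.ext rfl (funext fun t => StreamMechanism.answer_congr fun r _ x => hout r x p.2)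

end StreamAdversary

theorem StreamMechanism.IsAdaptiveZCDP.of_map {M M' : StreamMechanism n}
    {N : (Fin n → ℝ) → (Fin n → ℝ) → Prop} {ρ : ℝ} (h : M'.IsAdaptiveZCDP.{u} N ρ)
    {ψ : M'.Seed → M.Seed} (hψ : Measurable ψ) (hlaw : M.law = M'.law.map ψ)
    (hout : ∀ t x w, M.out t x (ψ w) = M'.out t x w) : M.IsAdaptiveZCDP.{u} N ρ := by
  intro A hA α hα
  rw [StreamAdversary.view_congr hψ hlaw hout A.measurable_left,
    StreamAdversary.view_congr hψ hlaw hout A.measurable_right]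
  exact h A hA α hα

theorem SingleParticipation.symm {κ : ℝ} {x y : Fin n → ℝ} (h : SingleParticipation n κ x y) :
    SingleParticipation n κ y x := by
  obtain ⟨i, hi, hκ⟩ := h
  exact ⟨i, fun j hj => (hi j hj).symm, by rwa [abs_sub_comm]⟩

theorem SingleParticipation.eq_of_zero {x y : Fin n → ℝ} (h : SingleParticipation n 0 x y) :
    x = y := by
  obtain ⟨i, hi, hκ⟩ := h
  funext j
  obtain rfl | hj := eq_or_ne j i
  exacts [sub_eq_zero.1 (abs_nonpos_iff.1 hκ), hi j hj]

theorem StreamAdversary.Valid.left_eq_right {A : StreamAdversary.{u} n}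
    (hA : A.Valid Eq) : A.left = A.right := by
  funext t c a
  simpa using congrFun (hA c fun s => if hs : s.val < t.val then a ⟨s, hs⟩ else 0) t

theorem StreamMechanism.isAdaptiveZCDP_eq (M : StreamMechanism n) {ρ : ℝ} (hρ : 0 ≤ ρ) :
    M.IsAdaptiveZCDP.{u} Eq ρ := by
  intro A hA α hα
  have : IsProbabilityMeasure (A.view M A.right) :=
    Measure.isProbabilityMeasure_map (A.measurable_view M _ A.measurable_right).aemeasurable
  rw [StreamAdversary.Valid.left_eq_right hA, renyiDiv_self]
  exact ⟨by exact_mod_cast (by positivity), by exact_mod_cast (by positivity)⟩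

theorem StreamMechanism.IsAdaptiveZCDP.anti {M : StreamMechanism n}
    {N N' : (Fin n → ℝ) → (Fin n → ℝ) → Prop} {ρ : ℝ} (h : M.IsAdaptiveZCDP.{u} N' ρ)
    (hN : ∀ x y, N x y → N' x y) : M.IsAdaptiveZCDP.{u} N ρ :=
  fun A hA => h A fun c a => hN _ _ (hA c a)

end AdaptiveStreams

section GaussianPrefixSum

open scoped RealInnerProductSpace

variable {n : ℕ} {E : Type} [NormedAddCommGroup E] [InnerProductSpace ℝ E] [FiniteDimensional ℝ E]
  [MeasurableSpace E] [BorelSpace E]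

/-- The mechanism that releases the prefix sums with the noise `⟪l t, w⟫` at step `t`, where `w` is
a standard Gaussian vector of `E`. -/
noncomputable def gaussianPrefixSumMechanism (l : Fin n → E) : StreamMechanism n where
  Seed := E
  measurableSpace := inferInstance
  law := stdGaussian E
  isProb := inferInstance
  out t x w := ∑ s, x s + ⟪l t, w⟫
  measurable_out t := by fun_prop

/-- The answers of `gaussianPrefixSumMechanism l` to the strategy `q`, as a function of the Gaussian
vector. -/
noncomputable def gaussianPrefixSumAnswer (l : Fin n → E) (q : (t : Fin n) → (Fin t → ℝ) → ℝ)
    (w : E) : Fin n → ℝ :=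
  (gaussianPrefixSumMechanism l).answer q w

/-- The shift of the Gaussian vector which compensates for feeding `q` instead of `q'` to
`gaussianPrefixSumMechanism l`: the answers to `q'` for the vector `w` are those to `q` for the
shifted vector, when `μ i` shifts the noise by one from step `i` on. -/
noncomputable def compensatingShift (l μ : Fin n → E) (q q' : (t : Fin n) → (Fin t → ℝ) → ℝ)
    (w : E) : E :=
  ∑ i, (adaptiveStream q' (gaussianPrefixSumAnswer l q' w) i -
    adaptiveStream q (gaussianPrefixSumAnswer l q' w) i) • μ i

theorem sum_take_eq_sum_Iic {M : Type*} [AddCommMonoid M] (f : Fin n → M) (t : Fin n) :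
    ∑ s, Fin.take (t + 1) t.isLt f s = ∑ i ∈ Finset.Iic t, f i := by
  have h := Fin.sum_Iic_castLE t.isLt f (Fin.last t)
  rw [show Fin.castLE t.isLt (Fin.last t) = t from rfl, ← Fin.top_eq_last, Finset.Iic_top] at h
  exact h.symm

variable {l μ : Fin n → E} {q q' : (t : Fin n) → (Fin t → ℝ) → ℝ}

theorem gaussianPrefixSumMechanism_out_take (x : Fin n → ℝ) (w : E) (t : Fin n) :
    (gaussianPrefixSumMechanism l).out t (Fin.take (t + 1) t.isLt x) w =
      ∑ i ∈ Finset.Iic t, x i + ⟪l t, w⟫ :=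
  congrArg (· + ⟪l t, w⟫) (sum_take_eq_sum_Iic x t)

theorem gaussianPrefixSumAnswer_apply (l : Fin n → E) (q : (t : Fin n) → (Fin t → ℝ) → ℝ) (w : E)
    (t : Fin n) :
    gaussianPrefixSumAnswer l q w t =
      ∑ i ∈ Finset.Iic t, adaptiveStream q (gaussianPrefixSumAnswer l q w) i + ⟪l t, w⟫ :=
  ((gaussianPrefixSumMechanism l).answer_apply q w t).trans
    (gaussianPrefixSumMechanism_out_take _ w t)

theorem eq_gaussianPrefixSumAnswer {a : Fin n → ℝ} {w : E}
    (ha : ∀ t, a t = ∑ i ∈ Finset.Iic t, adaptiveStream q a i + ⟪l t, w⟫) :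
    a = gaussianPrefixSumAnswer l q w :=
  funext fun _ => StreamMechanism.eq_answer_of_forall_le fun r _ =>
    (ha r).trans (gaussianPrefixSumMechanism_out_take _ w r).symm

theorem gaussianPrefixSumAnswer_congr {w w' : E} {t : Fin n} (h : ∀ r ≤ t, ⟪l r, w⟫ = ⟪l r, w'⟫) :
    gaussianPrefixSumAnswer l q w t = gaussianPrefixSumAnswer l q w' t :=
  StreamMechanism.answer_congr fun r hr x => congrArg (∑ s, x s + ·) (h r hr)

theorem gaussianPrefixSumAnswer_add_smul (hlμ : ∀ t i, ⟪l t, μ i⟫ = if i ≤ t then 1 else 0)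
    {t j : Fin n} (htj : t < j) (c : ℝ) (w : E) :
    gaussianPrefixSumAnswer l q (w + c • μ j) t = gaussianPrefixSumAnswer l q w t :=
  gaussianPrefixSumAnswer_congr fun r hr => by
    simp [inner_add_right, inner_smul_right, hlμ, (hr.trans_lt htj).not_ge]

theorem gaussianPrefixSumAnswer_add_compensatingShift
    (hlμ : ∀ t i, ⟪l t, μ i⟫ = if i ≤ t then 1 else 0) (w : E) :
    gaussianPrefixSumAnswer l q (w + compensatingShift l μ q q' w) =
      gaussianPrefixSumAnswer l q' w := by
  refine (eq_gaussianPrefixSumAnswer fun t => ?_).symm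
  have hnoise : ⟪l t, compensatingShift l μ q q' w⟫ = ∑ i ∈ Finset.Iic t,
      (adaptiveStream q' (gaussianPrefixSumAnswer l q' w) i -
        adaptiveStream q (gaussianPrefixSumAnswer l q' w) i) := by
    simp [compensatingShift, inner_sum, inner_smul_right, hlμ, ← Finset.sum_filter,
      Finset.filter_ge_eq_Iic]
  rw [inner_add_right, hnoise, Finset.sum_sub_distrib, gaussianPrefixSumAnswer_apply]
  ring

theorem norm_compensatingShift_sq_le {κ B : ℝ} (hμ : ∀ i, κ ^ 2 * ‖μ i‖ ^ 2 ≤ B)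
    (hq : ∀ a : Fin n → ℝ, SingleParticipation n κ (adaptiveStream q a) (adaptiveStream q' a))
    (w : E) : ‖compensatingShift l μ q q' w‖ ^ 2 ≤ B := by
  obtain ⟨i, hi, hiκ⟩ := (hq (gaussianPrefixSumAnswer l q' w)).symm
  rw [compensatingShift, Finset.sum_eq_single i
    (fun j _ hj => by rw [hi j hj, sub_self, zero_smul]) (by simp), norm_smul, mul_pow]
  refine le_trans ?_ (hμ i)
  gcongr
  exact hiκ

section View

variable {A : StreamAdversary.{u} n} {q q' : (t : Fin n) → A.Coins → (Fin t → ℝ) → ℝ}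
  (hq : ∀ t : Fin n, Measurable fun p : A.Coins × (Fin t → ℝ) => q t p.1 p.2)
  (hq' : ∀ t : Fin n, Measurable fun p : A.Coins × (Fin t → ℝ) => q' t p.1 p.2)

include hq hq'

theorem measurable_compensatingShift : Measurable fun p : A.Coins × E =>
    compensatingShift l μ (fun t => q t p.1) (fun t => q' t p.1) p.2 := by
  have hans := A.measurable_view (gaussianPrefixSumMechanism l) q' hq'
  refine Finset.measurable_sum _ fun i _ => Measurable.smul_const (.sub ?_ ?_) _
  exacts [(measurable_adaptiveStream (hq' i)).comp hans,
    (measurable_adaptiveStream (hq i)).comp hans]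

theorem measurePreserving_add_smul_compensatingShift
    (hlμ : ∀ t i, ⟪l t, μ i⟫ = if i ≤ t then 1 else 0) (r : ℝ) :
    MeasurePreserving (fun p : A.Coins × E =>
        (p.1, p.2 + r • compensatingShift l μ (fun t => q t p.1) (fun t => q' t p.1) p.2))
      (A.law.prod volume) (A.law.prod volume) := by
  have hans := A.measurable_view (gaussianPrefixSumMechanism l) q' hq'
  have hm := measurable_compensatingShift (l := l) (μ := μ) hq hq'
  refine (MeasurePreserving.id A.law).skew_product (g := fun c w =>
    w + r • compensatingShift l μ (fun t => q t c) (fun t => q' t c) w)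
    (measurable_snd.add (hm.const_smul r)) (.of_forall fun c => ?_)
  simp only [compensatingShift, Finset.smul_sum, smul_smul]
  refine (measurePreserving_add_sum_smul Finset.univ (fun i => ?_) fun i j hij s w => ?_).map_eq
  · have hc : Measurable fun w : E => (c, w) := measurable_prodMk_left
    exact .const_mul (.sub ((measurable_adaptiveStream (hq' i)).comp (hans.comp hc))
      ((measurable_adaptiveStream (hq i)).comp (hans.comp hc))) r
  · have hpast : ∀ t < i, gaussianPrefixSumAnswer l (fun t => q' t c) (w + s • μ j) t =
        gaussianPrefixSumAnswer l (fun t => q' t c) w t :=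
      fun t ht => gaussianPrefixSumAnswer_add_smul hlμ (ht.trans_le hij) s w
    rw [adaptiveStream_congr _ hpast, adaptiveStream_congr _ hpast]

theorem renyiDiv_view_gaussianPrefixSumMechanism_le
    (hlμ : ∀ t i, ⟪l t, μ i⟫ = if i ≤ t then 1 else 0) {κ ρ : ℝ}
    (hμ : ∀ i, κ ^ 2 * ‖μ i‖ ^ 2 ≤ 2 * ρ)
    (hqq' : ∀ c a, SingleParticipation n κ (adaptiveStream (fun t => q t c) a)
      (adaptiveStream (fun t => q' t c) a)) {α : ℝ} (hα : 1 < α) :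
    renyiDiv α (A.view (gaussianPrefixSumMechanism l) q)
      (A.view (gaussianPrefixSumMechanism l) q') ≤ ((ρ * α : ℝ) : EReal) := by
  have hview : A.view (gaussianPrefixSumMechanism l) q' = (A.law.prod (stdGaussian E)).map
      fun p => (p.1, gaussianPrefixSumAnswer l (fun t => q t p.1)
        (p.2 + compensatingShift l μ (fun t => q t p.1) (fun t => q' t p.1) p.2)) := by
    simp only [gaussianPrefixSumAnswer_add_compensatingShift hlμ]
    rfl
  rw [hview]
  exact renyiDiv_map_add_le hα (measurable_compensatingShift hq hq')
    (measurePreserving_add_smul_compensatingShift hq hq' hlμ)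
    (fun p => norm_compensatingShift_sq_le hμ (hqq' p.1) p.2)
    (A.measurable_view (gaussianPrefixSumMechanism l) q hq)

end View

theorem isAdaptiveZCDP_gaussianPrefixSumMechanism
    (hlμ : ∀ t i, ⟪l t, μ i⟫ = if i ≤ t then 1 else 0) {κ ρ : ℝ}
    (hμ : ∀ i, κ ^ 2 * ‖μ i‖ ^ 2 ≤ 2 * ρ) :
    (gaussianPrefixSumMechanism l).IsAdaptiveZCDP.{u} (SingleParticipation n κ) ρ :=
  fun A hA _ hα =>
    ⟨renyiDiv_view_gaussianPrefixSumMechanism_le A.measurable_left A.measurable_right hlμ hμ hA hα,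
      renyiDiv_view_gaussianPrefixSumMechanism_le A.measurable_right A.measurable_left hlμ hμ
        (fun c a => (hA c a).symm) hα⟩

end GaussianPrefixSum

section FFT

open scoped RealInnerProductSpace ComplexConjugate

theorem stdComplexNormal_eq_stdGaussian : stdComplexNormal = stdGaussian ℂ := by
  rw [stdGaussian_eq_map_pi_orthonormalBasis Complex.orthonormalBasisOneI, stdComplexNormal,
    ← (measurePreserving_finTwoArrow (gaussianReal 0 1)).map_eq, Measure.map_map
      (MeasurableEquiv.measurable _) (MeasurableEquiv.measurable _)]
  congr 1
  funext x
  apply Complex.ext <;> simp [MeasurableEquiv.finTwoArrow, Complex.measurableEquivRealProd]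

theorem sum_zpow_mul_of_isPrimitiveRoot {K : Type*} [Field K] {ζ : K} {N : ℕ}
    (hζ : IsPrimitiveRoot ζ N) (m : ℤ) :
    ∑ k : Fin N, ζ ^ ((k : ℤ) * m) = if (N : ℤ) ∣ m then (N : K) else 0 := by
  have hpow (k : Fin N) : ζ ^ ((k : ℤ) * m) = (ζ ^ m) ^ (k : ℕ) := by
    rw [mul_comm, zpow_mul, zpow_natCast]
  simp only [hpow, Fin.sum_univ_eq_sum_range fun k => (ζ ^ m) ^ k]
  split_ifs with hm
  · simp [(hζ.zpow_eq_one_iff_dvd m).2 hm]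
  · rw [geom_sum_eq (mt (hζ.zpow_eq_one_iff_dvd m).1 hm), ← zpow_natCast, ← zpow_mul, mul_comm,
      zpow_mul, zpow_natCast, hζ.pow_eq_one, one_zpow, sub_self, zero_div]

theorem natCast_dvd_sub_sub_iff {N : ℕ} (t a i : Fin N) :
    (N : ℤ) ∣ (t : ℤ) - a - i ↔ a = t - i := by
  have hmod : (N : ℤ) ∣ (t : ℤ) - a - i ↔ (N : ℤ) ∣ ((t - i : Fin N) : ℤ) - a := by
    rw [Fin.coe_int_sub_eq_ite]
    split_ifs
    · rw [sub_right_comm]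
    · rw [show (t : ℤ) - i + N - a = t - a - i + N by ring, dvd_add_self_right]
  rw [hmod]
  refine ⟨fun h => ?_, fun h => by simp [h]⟩
  have hzero := Int.eq_zero_of_abs_lt_dvd h (abs_lt.2 (by constructor <;> omega))
  exact Fin.ext (by omega)

/-- The primitive root of unity underlying the DFT in dimension `2n`. -/
noncomputable def fftRoot (n : ℕ) : ℂ := Complex.exp (2 * Real.pi * Complex.I / (2 * n : ℕ))

/-- The time step `t` as an index of the DFT in dimension `2n`. -/
def fftIndex {n : ℕ} (t : Fin n) : Fin (2 * n) := ⟨t, by omega⟩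

variable {n : ℕ}

theorem isPrimitiveRoot_fftRoot (hn : 0 < n) : IsPrimitiveRoot (fftRoot n) (2 * n) :=
  Complex.isPrimitiveRoot_exp _ (by omega)

theorem norm_fftRoot (hn : 0 < n) : ‖fftRoot n‖ = 1 :=
  (isPrimitiveRoot_fftRoot hn).norm'_eq_one (by omega)

theorem fftRoot_ne_zero (n : ℕ) : fftRoot n ≠ 0 :=
  Complex.exp_ne_zero _

theorem exp_eq_fftRoot_zpow (n k a : ℕ) :
    Complex.exp (-(Complex.I * 2 * Real.pi * k * a) / (2 * n)) =
      fftRoot n ^ ((k : ℤ) * -(a : ℤ)) := by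
  rw [fftRoot, ← Complex.exp_int_mul]
  congr 1
  push_cast
  ring

theorem fftVDFT_eq_sum (k : Fin (2 * n)) :
    fftVDFT n k = ∑ a, fftV n a * fftRoot n ^ ((k : ℤ) * -(a : ℤ)) := by
  simp only [fftVDFT, exp_eq_fftRoot_zpow]

theorem fftMatrix_apply (k a : Fin (2 * n)) :
    fftMatrix n k a = ((1 / √(2 * n) : ℝ) : ℂ) * fftRoot n ^ ((k : ℤ) * -(a : ℤ)) := by
  rw [fftMatrix, Matrix.of_apply, exp_eq_fftRoot_zpow]

theorem norm_fftMatrix_sq (hn : 0 < n) (k a : Fin (2 * n)) :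
    ‖fftMatrix n k a‖ ^ 2 = 1 / (2 * n) := by
  rw [fftMatrix_apply, norm_mul, norm_zpow, norm_fftRoot hn, one_zpow, mul_one,
    Complex.norm_real, Real.norm_eq_abs, sq_abs, div_pow, one_pow, Real.sq_sqrt (by positivity)]

theorem conj_fftMatrix_mul_fftMatrix (hn : 0 < n) (k t i : Fin (2 * n)) :
    conj (fftMatrix n k t) * fftMatrix n k i =
      (2 * n : ℂ)⁻¹ * fftRoot n ^ ((k : ℤ) * (t - i)) := by
  have hconj : conj (fftRoot n) = (fftRoot n)⁻¹ := (Complex.inv_eq_conj (norm_fftRoot hn)).symm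
  have hscale : ((1 / √(2 * n) : ℝ) : ℂ) * ((1 / √(2 * n) : ℝ) : ℂ) = (2 * n : ℂ)⁻¹ := by
    rw [← Complex.ofReal_mul, div_mul_div_comm, Real.mul_self_sqrt (by positivity)]
    push_cast
    ring
  rw [fftMatrix_apply, fftMatrix_apply, map_mul, Complex.conj_ofReal, map_zpow₀, hconj, inv_zpow',
    mul_mul_mul_comm, hscale, ← zpow_add₀ (fftRoot_ne_zero n)]
  ring_nf

theorem sum_conj_fftMatrix_mul_fftVDFT_mul (hn : 0 < n) (t i : Fin (2 * n)) :
    ∑ k, conj (fftMatrix n k t) * fftVDFT n k * fftMatrix n k i = fftV n (t - i) := by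
  have hn₀ : (2 * n : ℂ) ≠ 0 := by exact_mod_cast (by omega : 2 * n ≠ 0)
  have hterm (k : Fin (2 * n)) : conj (fftMatrix n k t) * fftVDFT n k * fftMatrix n k i =
      ∑ a, fftV n a * ((2 * n : ℂ)⁻¹ * fftRoot n ^ ((k : ℤ) * (t - a - i))) := by
    rw [mul_right_comm, conj_fftMatrix_mul_fftMatrix hn, fftVDFT_eq_sum, Finset.mul_sum]
    refine Finset.sum_congr rfl fun a _ => ?_
    rw [mul_left_comm, mul_assoc, ← zpow_add₀ (fftRoot_ne_zero n)]
    ring_nf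
  simp only [hterm]
  rw [Finset.sum_comm]
  simp only [← Finset.mul_sum, sum_zpow_mul_of_isPrimitiveRoot (isPrimitiveRoot_fftRoot hn),
    natCast_dvd_sub_sub_iff]
  simp only [mul_ite, mul_zero, Finset.sum_ite_eq', Finset.mem_univ, if_true]
  push_cast
  rw [inv_mul_cancel₀ hn₀, mul_one]

theorem fftV_fftIndex_sub (t i : Fin n) :
    fftV n (fftIndex t - fftIndex i) = if i ≤ t then 1 else 0 := by
  refine if_congr ?_ rfl rfl
  obtain hit | hti := le_or_gt i t
  · rw [Fin.coe_sub_iff_le.2 (show fftIndex i ≤ fftIndex t from hit)]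
    simp only [fftIndex, hit, iff_true]
    omega
  · rw [Fin.coe_sub_iff_lt.2 (show fftIndex t < fftIndex i from hti)]
    simp only [fftIndex, hti.not_ge, iff_false]
    omega

theorem sum_norm_fftVDFT_pos (hn : 0 < n) : 0 < ∑ k, ‖fftVDFT n k‖ := by
  refine (Finset.sum_nonneg fun k _ => norm_nonneg _).lt_of_ne' fun h => ?_
  have hzero (k) : fftVDFT n k = 0 := by
    simpa using (Finset.sum_eq_zero_iff_of_nonneg fun k _ => norm_nonneg _).1 h k
  let t : Fin n := ⟨0, hn⟩
  simpa [hzero, fftV_fftIndex_sub] using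
    sum_conj_fftMatrix_mul_fftVDFT_mul hn (fftIndex t) (fftIndex t)

/-- The diagonal entries of `Σ^{1/2}`. -/
noncomputable def fftSqrtEntry (n : ℕ) (k : Fin (2 * n)) : ℂ := fftVDFT n k ^ (1 / 2 : ℂ)

theorem fftSqrtEntry_mul_self (k : Fin (2 * n)) :
    fftSqrtEntry n k * fftSqrtEntry n k = fftVDFT n k := by
  rw [← pow_two, fftSqrtEntry, one_div]
  exact Complex.cpow_nat_inv_pow (fftVDFT n k) two_ne_zero

theorem norm_fftSqrtEntry_sq (k : Fin (2 * n)) : ‖fftSqrtEntry n k‖ ^ 2 = ‖fftVDFT n k‖ := by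
  rw [pow_two, ← norm_mul, fftSqrtEntry_mul_self]

/-- The vector whose inner product with `w` is `Re z_t`, where `z = σ F^* Σ^{1/2} w`. -/
noncomputable def fftNoiseVector (n : ℕ) (σ : ℝ) (t : Fin n) : PiLp 2 fun _ : Fin (2 * n) => ℂ :=
  WithLp.toLp 2 fun k => conj (σ * (conj (fftMatrix n k (fftIndex t)) * fftSqrtEntry n k))

/-- The shift `σ⁻¹ Σ^{1/2} F e_i` of `w`, which adds one to each of `Re z_i, …, Re z_{n-1}` and does
not change `Re z_t` for `t < i`. -/
noncomputable def fftShiftVector (n : ℕ) (σ : ℝ) (i : Fin n) : PiLp 2 fun _ : Fin (2 * n) => ℂ :=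
  WithLp.toLp 2 fun k => (σ : ℂ)⁻¹ * (fftSqrtEntry n k * fftMatrix n k (fftIndex i))

theorem re_fftNoise (κ ρ : ℝ) (w : PiLp 2 fun _ : Fin (2 * n) => ℂ) (t : Fin n) :
    (fftNoise n κ ρ w.ofLp (fftIndex t)).re = ⟪fftNoiseVector n (fftSigma n κ ρ) t, w⟫ := by
  rw [PiLp.inner_apply, fftNoise, Pi.smul_apply, fftSqrtSigma, Matrix.mulVec, dotProduct,
    smul_eq_mul, Finset.mul_sum, Complex.re_sum]
  refine Finset.sum_congr rfl fun k _ => ?_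
  rw [Matrix.mulVec_diagonal, Complex.inner, fftNoiseVector, Complex.conj_conj,
    Matrix.conjTranspose_apply, fftSqrtEntry, RCLike.star_def]
  ring_nf

theorem inner_fftNoiseVector_fftShiftVector (hn : 0 < n) {σ : ℝ} (hσ : σ ≠ 0) (t i : Fin n) :
    ⟪fftNoiseVector n σ t, fftShiftVector n σ i⟫ = if i ≤ t then 1 else 0 := by
  have hσ' : (σ : ℂ) ≠ 0 := by exact_mod_cast hσ
  have hcirc := (sum_conj_fftMatrix_mul_fftVDFT_mul hn (fftIndex t) (fftIndex i)).trans
    (fftV_fftIndex_sub t i)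
  calc ⟪fftNoiseVector n σ t, fftShiftVector n σ i⟫
      = (∑ k, conj (fftMatrix n k (fftIndex t)) * fftVDFT n k * fftMatrix n k (fftIndex i)).re := by
        rw [PiLp.inner_apply, Complex.re_sum]
        refine Finset.sum_congr rfl fun k _ => ?_
        rw [Complex.inner, fftNoiseVector, fftShiftVector, Complex.conj_conj,
          ← fftSqrtEntry_mul_self]
        congr 1
        field_simp
    _ = if i ≤ t then 1 else 0 := by rw [hcirc]; split_ifs <;> rfl

theorem norm_fftShiftVector_sq (hn : 0 < n) (σ : ℝ) (i : Fin n) :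
    ‖fftShiftVector n σ i‖ ^ 2 = (∑ k, ‖fftVDFT n k‖) / (2 * n * σ ^ 2) := by
  rw [PiLp.norm_sq_eq_of_L2, Finset.sum_div]
  refine Finset.sum_congr rfl fun k _ => ?_
  rw [fftShiftVector, norm_mul, norm_mul, mul_pow, mul_pow, norm_fftSqrtEntry_sq,
    norm_fftMatrix_sq hn, norm_inv, Complex.norm_real, Real.norm_eq_abs, inv_pow, sq_abs]
  field_simp

theorem sq_fftSigma (n : ℕ) (κ : ℝ) {ρ : ℝ} (hρ : 0 ≤ ρ) :
    fftSigma n κ ρ ^ 2 = κ ^ 2 * (∑ k, ‖fftVDFT n k‖) / (4 * n * ρ) :=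
  Real.sq_sqrt (by positivity)

theorem fftSigma_pos (hn : 0 < n) {κ ρ : ℝ} (hκ : κ ≠ 0) (hρ : 0 < ρ) : 0 < fftSigma n κ ρ := by
  have hsum := sum_norm_fftVDFT_pos hn
  exact Real.sqrt_pos.2 (by positivity)

theorem mul_norm_fftShiftVector_sq (hn : 0 < n) {κ ρ : ℝ} (hκ : κ ≠ 0) (hρ : 0 < ρ) (i : Fin n) :
    κ ^ 2 * ‖fftShiftVector n (fftSigma n κ ρ) i‖ ^ 2 = 2 * ρ := by
  have hsum := sum_norm_fftVDFT_pos hn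
  rw [norm_fftShiftVector_sq hn, sq_fftSigma n κ hρ.le]
  field_simp
  ring

theorem fftMechanism_law (n : ℕ) (κ ρ : ℝ) : (fftMechanism n κ ρ).law =
    (stdGaussian (PiLp 2 fun _ : Fin (2 * n) => ℂ)).map WithLp.ofLp := by
  rw [← map_pi_stdGaussian, Measure.map_map (WithLp.measurable_ofLp _ _)
    (WithLp.measurable_toLp _ _), ← stdComplexNormal_eq_stdGaussian]
  exact Measure.map_id.symm

theorem StreamMechanism.IsAdaptiveZCDP.fftMechanism {κ ρ r : ℝ}
    {N : (Fin n → ℝ) → (Fin n → ℝ) → Prop}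
    (h : (gaussianPrefixSumMechanism (fftNoiseVector n (fftSigma n κ ρ))).IsAdaptiveZCDP.{u} N r) :
    (fftMechanism n κ ρ).IsAdaptiveZCDP.{u} N r :=
  h.of_map (WithLp.measurable_ofLp _ _) (fftMechanism_law n κ ρ)
    fun t x w => congrArg (∑ s, x s + ·) (re_fftNoise κ ρ w t)

end FFT

theorem mainTheorem8 (n : ℕ) (hn : 0 < n) (κ ρ : ℝ) (hκ : 0 ≤ κ) (hρ : 0 < ρ) :
    (fftMechanism n κ ρ).IsAdaptiveZCDP.{u} (SingleParticipation n κ) ρ := by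
  obtain rfl | hκ_pos := hκ.eq_or_lt
  · exact (StreamMechanism.isAdaptiveZCDP_eq _ hρ.le).anti fun _ _ h => h.eq_of_zero
  · have hσ : fftSigma n κ ρ ≠ 0 := (fftSigma_pos hn hκ_pos.ne' hρ).ne'
    refine (isAdaptiveZCDP_gaussianPrefixSumMechanism (μ := fftShiftVector n (fftSigma n κ ρ))
      (inner_fftNoiseVector_fftShiftVector hn hσ) fun i => ?_).fftMechanism
    exact (mul_norm_fftShiftVector_sq hn hκ_pos.ne' hρ i).le
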